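/- Let $l$ and $m$ be positive integers and let $\alpha$ be a real number with $\alpha\in\left[-2,\frac{-4}{l+2}\right]$ if $l$ is even, and $\alpha\in\left[-2,\frac{-4(l+2)}{(l+1)(l+3)}\right]$ if $l$ is odd. Put $p=p(n)=n^{\alpha}$ for $n\ge 1$, and let $G(n,p)$ be the random graph on $n$ vertices in which each edge appears independently with probability $p$. For a graph $G$, let $N_m(G)$ be the multineighbor complex of $G$: the simplicial complex whose simplices are the nonempty finite sets of vertices of $G$ that have at least $m$ common neighbors in $G$. Then asymptotically almost surely the reduced homology of $N_m(G(n,p))$ vanishes in degree $l$; that is, for every commutative ring $R$ (for example $R=\mathbb{Z}$), \[ \lim_{n\to\infty}\mathbb{P}\bigl(\tilde H_l(N_m(G(n,p));R)=0\bigr)=1 . \] -/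

import Mathlib

open Filter Topology

noncomputable section

/-- The multineighbor complex `N_m(G)`: a nonempty finite set of vertices of `G` is a simplex
iff its elements have at least `m` common neighbors in `G`. -/
def multineighborComplex {V : Type*} (m : ℕ) (G : SimpleGraph V) :
    PreAbstractSimplicialComplex V where
  faces := {s | s.Nonempty ∧ (m : ℕ∞) ≤ {w : V | ∀ u ∈ s, G.Adj u w}.encard}
  isRelLowerSet_faces := by
    intro s hs
    refine ⟨hs.1, fun t hts ht => ⟨ht, hs.2.trans (Set.encard_le_encard ?_)⟩⟩
    exact fun w hw u hu => hw u (hts hu)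

/-- The module `Z / B` for submodules `B ≤ Z` of the same module (in general, `Z / (B ∩ Z)`). -/
abbrev Submodule.Subquotient {R M : Type*} [CommRing R] [AddCommGroup M] [Module R M]
    (Z B : Submodule R M) : Type _ :=
  ↥Z ⧸ B.submoduleOf Z

namespace PreAbstractSimplicialComplex

variable {V : Type*}

/-- Augmented simplicial chains of `K` spanned by the faces with exactly `k` vertices, i.e. those of
dimension `k - 1`. For `k = 0` the only generator is the empty simplex. -/
def augChains (R : Type*) [CommRing R] (K : PreAbstractSimplicialComplex V) (k : ℕ) :
    Submodule R (Finset V →₀ R) :=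
  Finsupp.supported R R {s | s.card = k ∧ (s ∈ K.faces ∨ s = ∅)}

/-- The simplicial boundary map with respect to a linear order of the vertices:
`∂[v₀ < ⋯ < v_q] = ∑ i, (-1) ^ i • [v₀, …, v̂ᵢ, …, v_q]`. The index of `v` in `s` is the number of
elements of `s` below `v`. In particular `∂[v] = ∅` is the augmentation. -/
def simplicialBoundary (V : Type*) [LinearOrder V] (R : Type*) [CommRing R] :
    (Finset V →₀ R) →ₗ[R] (Finset V →₀ R) :=
  Finsupp.linearCombination R fun s : Finset V =>
    ∑ v ∈ s, (-1 : R) ^ (s.filter (· < v)).card • Finsupp.single (s.erase v) (1 : R)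

variable [LinearOrder V]

theorem simplicialBoundary_simplicialBoundary {R : Type*} [CommRing R] (c : Finset V →₀ R) :
    simplicialBoundary V R (simplicialBoundary V R c) = 0 := by
  suffices h : simplicialBoundary V R ∘ₗ simplicialBoundary V R = 0 from LinearMap.congr_fun h c
  ext1 s
  ext1
  simp only [LinearMap.comp_apply, Finsupp.lsingle_apply, simplicialBoundary,
    Finsupp.linearCombination_single, one_smul, map_sum, map_smul, LinearMap.zero_apply,
    Finset.smul_sum]
  rw [Finset.sum_sigma']
  refine Finset.sum_involution (fun x _ => ⟨x.2, x.1⟩) ?_ ?_ ?_ ?_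
  · rintro ⟨v, w⟩ h
    simp only [Finset.mem_sigma, Finset.mem_erase] at h
    obtain ⟨hv, hwv, hw⟩ := h
    simp only [smul_smul, Finset.erase_right_comm (a := w) (b := v), ← add_smul]
    convert zero_smul R _
    have key : ∀ a b : V, a ∈ s → b ∈ s → a < b →
        (s.filter (· < b)).card = ((s.erase a).filter (· < b)).card + 1 ∧
        ((s.erase b).filter (· < a)) = s.filter (· < a) := by
      intro a b ha hb hab
      constructor
      · rw [Finset.filter_erase, Finset.card_erase_add_one]
        simp [ha, hab]
      · rw [Finset.filter_erase, Finset.erase_eq_of_notMem]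
        simp [hab.le]
    rcases lt_or_gt_of_ne hwv with h | h
    · obtain ⟨h1, h2⟩ := key w v hw hv h
      rw [h1, h2]; ring
    · obtain ⟨h1, h2⟩ := key v w hv hw h
      rw [h1, h2]; ring
  · rintro ⟨v, w⟩ h _ h'
    simp only [Finset.mem_sigma, Finset.mem_erase] at h
    simp at h'
    exact h.2.1 h'.1
  · rintro ⟨v, w⟩ h
    simp only [Finset.mem_sigma, Finset.mem_erase] at h ⊢
    exact ⟨h.2.2, h.2.1.symm, h.1⟩
  · rintro ⟨v, w⟩ h; rfl

/-- Augmented simplicial cycles of dimension `l`. -/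
def reducedCycles (R : Type*) [CommRing R] (K : PreAbstractSimplicialComplex V) (l : ℕ) :
    Submodule R (Finset V →₀ R) :=
  K.augChains R (l + 1) ⊓ LinearMap.ker (simplicialBoundary V R)

/-- Simplicial boundaries of dimension `l`. -/
def reducedBoundaries (R : Type*) [CommRing R] (K : PreAbstractSimplicialComplex V) (l : ℕ) :
    Submodule R (Finset V →₀ R) :=
  (K.augChains R (l + 2)).map (simplicialBoundary V R)

theorem reducedBoundaries_le_reducedCycles (R : Type*) [CommRing R]
    (K : PreAbstractSimplicialComplex V) (l : ℕ) :
    K.reducedBoundaries R l ≤ K.reducedCycles R l := by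
  rintro _ ⟨c, hc, rfl⟩
  refine ⟨?_, LinearMap.mem_ker.2 (simplicialBoundary_simplicialBoundary c)⟩
  rw [simplicialBoundary, Finsupp.linearCombination_apply]
  refine Submodule.sum_mem _ fun s hs => Submodule.smul_mem _ _ (Submodule.sum_mem _ fun v hv =>
    Submodule.smul_mem _ _ (Finsupp.single_mem_supported _ _ ?_))
  obtain ⟨hcard, hK | h⟩ := (Finsupp.mem_supported R c).1 hc hs
  · have hc' : (s.erase v).card = l + 1 := by
      rw [Finset.card_erase_of_mem hv, hcard]; rfl
    refine ⟨hc', Or.inl ((K.isRelLowerSet_faces hK).2 (Finset.erase_subset v s) ?_)⟩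
    exact Finset.card_pos.1 (by omega)
  · simp [h] at hcard

/-- The reduced simplicial homology module `H̃_l(K; R)`: cycles modulo boundaries in the augmented
simplicial chain complex of `K`. -/
abbrev ReducedHomology (R : Type*) [CommRing R] (K : PreAbstractSimplicialComplex V) (l : ℕ) :
    Type _ :=
  Submodule.Subquotient (K.reducedCycles R l) (K.reducedBoundaries R l)

end PreAbstractSimplicialComplex

end

/-!
The neighborhood structure of a graph gives a closure operator on the faces of its multineighbor
complex: the closure of a face consists of the common neighbors of its common neighbors. The complex
retracts onto the order complex of its closed faces, so its homology in degree `l` vanishes unless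
there are `l + 1` closed faces in a strictly increasing chain
(`PreAbstractSimplicialComplex.subsingleton_reducedHomology_of_closure`). The retraction is realized
on chains: choosing a vertex in each closed face, one gets a chain map which is homotopic to the
identity and sends a simplex to a signed sum over its flags, where a flag with two equal closures
contributes zero.

A strictly increasing chain of `l + 1` closed faces yields a half graph with sides
`a 0, …, a l` and `b 0, …, b l`, where `a i` and `b j` are adjacent for `i ≤ j`. For `s + t = l + 2`
it contains the complete bipartite graph `K_{s,t}`. With `s` and `t` as equal as possible, the bound
on `α` is the threshold for the appearance of `K_{s,t}`, so at the endpoint of the interval `K_{s,t}`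
itself may appear; but the half graph also contains a further vertex with `t - 1` neighbors in
`K_{s,t}`, and by the first moment method the resulting `s + t + 1` vertices and `s t + t - 1` edges
do not appear asymptotically almost surely (`SimpleGraph.tendsto_binomialRandom_exists_dense`).

For `l = 2` this further vertex is only a pendant one, and the argument fails at `α = -1`. There,
however, asymptotically almost surely no set of at most seven vertices spans more edges than it has vertices, so
that `4`-cycles are far apart, and every `2`-cycle of the complex splits into cycles each of which
lies in the simplex spanned by the neighborhood of one vertex
(`PreAbstractSimplicialComplex.subsingleton_reducedHomology_two_of_sparse`).
-/

/-! ### Cones, closure operators and vanishing of homology -/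

namespace PreAbstractSimplicialComplex

section Cone

variable {V : Type*} [LinearOrder V] {R : Type*} [CommRing R]

theorem simplicialBoundary_single (s : Finset V) :
    simplicialBoundary V R (Finsupp.single s 1) =
      ∑ v ∈ s, (-1 : R) ^ (s.filter (· < v)).card • Finsupp.single (s.erase v) (1 : R) := by
  simp [simplicialBoundary]

/-- The cone operator with apex `x`: it sends an oriented simplex `s` to `x ∧ s`, hence to `0` when
`x ∈ s`. The sign moves `x` from the first place to its place in the linear order. -/
noncomputable def coneOp (R : Type*) [CommRing R] (x : V) : (Finset V →₀ R) →ₗ[R] (Finset V →₀ R) :=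
  Finsupp.linearCombination R fun s : Finset V =>
    if x ∈ s then 0 else (-1 : R) ^ (s.filter (· < x)).card • Finsupp.single (insert x s) (1 : R)

theorem coneOp_single (x : V) (s : Finset V) :
    coneOp R x (Finsupp.single s 1) =
      if x ∈ s then 0 else
        (-1 : R) ^ (s.filter (· < x)).card • Finsupp.single (insert x s) (1 : R) := by
  simp [coneOp]

theorem coneOp_coneOp (x : V) (c : Finset V →₀ R) : coneOp R x (coneOp R x c) = 0 := by
  suffices h : coneOp R x ∘ₗ coneOp R x = 0 from LinearMap.congr_fun h c
  ext1 s
  ext1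
  simp only [LinearMap.comp_apply, Finsupp.lsingle_apply, coneOp_single, LinearMap.zero_apply]
  split_ifs with h
  · exact map_zero _
  · rw [map_smul, coneOp_single, if_pos (Finset.mem_insert_self x s), smul_zero]

/-- The cone operator is a contracting homotopy of the augmented chain complex of a simplex. -/
theorem simplicialBoundary_coneOp (x : V) (c : Finset V →₀ R) :
    simplicialBoundary V R (coneOp R x c) + coneOp R x (simplicialBoundary V R c) = c := by
  suffices h : simplicialBoundary V R ∘ₗ coneOp R x + coneOp R x ∘ₗ simplicialBoundary V R =
      LinearMap.id from LinearMap.congr_fun h c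
  ext1 s
  ext1
  simp only [LinearMap.comp_apply, Finsupp.lsingle_apply, LinearMap.add_apply, LinearMap.id_apply,
    coneOp_single, simplicialBoundary_single, map_sum, map_smul]
  by_cases hx : x ∈ s
  · rw [if_pos hx, map_zero, zero_add, Finset.sum_eq_single_of_mem x hx]
    · rw [if_neg (Finset.notMem_erase x s), Finset.insert_erase hx, Finset.filter_erase,
        Finset.erase_eq_of_notMem (by simp), smul_smul, ← mul_pow]
      simp
    · intro v _ hv
      rw [if_pos (Finset.mem_erase.2 ⟨hv.symm, hx⟩), smul_zero]
  · rw [if_neg hx, map_smul, simplicialBoundary_single, Finset.sum_insert hx, smul_add,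
      Finset.filter_insert, if_neg (lt_irrefl x), Finset.erase_insert hx, smul_smul, ← mul_pow,
      add_assoc, Finset.smul_sum, ← Finset.sum_add_distrib, Finset.sum_eq_zero]
    · simp
    · intro v hv
      have hvx : v ≠ x := fun h => hx (h ▸ hv)
      rw [if_neg (fun h => hx (Finset.mem_of_mem_erase h)), Finset.erase_insert_of_ne hvx.symm,
        smul_smul, smul_smul, ← add_smul]
      convert zero_smul R _
      rcases lt_or_gt_of_ne hvx with h | h
      · have h1 : (s.filter (· < x)).card = ((s.erase v).filter (· < x)).card + 1 := by
          rw [Finset.filter_erase, Finset.card_erase_add_one]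
          simp [hv, h]
        rw [Finset.filter_insert, if_neg h.not_gt, h1]
        ring
      · have h1 : (s.erase v).filter (· < x) = s.filter (· < x) := by
          rw [Finset.filter_erase, Finset.erase_eq_of_notMem]
          simp [h.le]
        rw [Finset.filter_insert, if_pos h, h1, Finset.card_insert_of_notMem (by simp [hx])]
        ring

theorem simplicialBoundary_coneOp_eq_sub (x : V) (c : Finset V →₀ R) :
    simplicialBoundary V R (coneOp R x c) = c - coneOp R x (simplicialBoundary V R c) :=
  eq_sub_of_add_eq (simplicialBoundary_coneOp x c)

theorem coneOp_mem_supported {x : V} {A : Finset V} (hx : x ∈ A) {k : ℕ} {c : Finset V →₀ R}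
    (hc : c ∈ Finsupp.supported R R {t : Finset V | t ⊆ A ∧ t.card = k}) :
    coneOp R x c ∈ Finsupp.supported R R {t : Finset V | t ⊆ A ∧ t.card = k + 1} := by
  rw [coneOp, Finsupp.linearCombination_apply]
  refine Submodule.sum_mem _ fun s hs => Submodule.smul_mem _ _ ?_
  obtain ⟨hsA, hsk⟩ := (Finsupp.mem_supported R c).1 hc hs
  split_ifs with h
  · exact Submodule.zero_mem _
  · refine Submodule.smul_mem _ _ (Finsupp.single_mem_supported _ _ ⟨?_, ?_⟩)
    · exact Finset.insert_subset hx hsA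
    · rw [Finset.card_insert_of_notMem h, hsk]

end Cone

section Closure

variable {V : Type*} [LinearOrder V] (R : Type*) [CommRing R] (apex : Finset V → V)

/-- A chain map which sends a simplex `s` with `k` vertices to the signed sum, over the complete
flags `s₁ ⊂ ⋯ ⊂ sₖ = s`, of the simplices with vertices `apex s₁, …, apex sₖ`. It is defined by
recursion on the number `k` of vertices and is meaningful on simplices with `k` vertices. -/
noncomputable def flagMap : ℕ → (Finset V →₀ R) →ₗ[R] (Finset V →₀ R)
  | 0 => LinearMap.id
  | k + 1 => Finsupp.linearCombination R fun s =>
      coneOp R (apex s) (flagMap k (simplicialBoundary V R (Finsupp.single s 1)))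

/-- A chain homotopy between the identity and `flagMap`. -/
noncomputable def flagHomotopy : ℕ → (Finset V →₀ R) →ₗ[R] (Finset V →₀ R)
  | 0 => 0
  | k + 1 => Finsupp.linearCombination R fun s =>
      coneOp R (apex s) (Finsupp.single s 1 - flagMap R apex (k + 1) (Finsupp.single s 1) -
        flagHomotopy k (simplicialBoundary V R (Finsupp.single s 1)))

theorem flagMap_succ_single (k : ℕ) (s : Finset V) :
    flagMap R apex (k + 1) (Finsupp.single s 1) =
      coneOp R (apex s) (flagMap R apex k (simplicialBoundary V R (Finsupp.single s 1))) := by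
  simp [flagMap]

theorem flagHomotopy_succ_single (k : ℕ) (s : Finset V) :
    flagHomotopy R apex (k + 1) (Finsupp.single s 1) =
      coneOp R (apex s) (Finsupp.single s 1 - flagMap R apex (k + 1) (Finsupp.single s 1) -
        flagHomotopy R apex k (simplicialBoundary V R (Finsupp.single s 1))) := by
  simp [flagHomotopy]

theorem simplicialBoundary_flagMap (k : ℕ) (c : Finset V →₀ R) :
    simplicialBoundary V R (flagMap R apex (k + 1) c) =
      flagMap R apex k (simplicialBoundary V R c) := by
  induction k generalizing c with
  | zero =>
    suffices h : simplicialBoundary V R ∘ₗ flagMap R apex 1 =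
        flagMap R apex 0 ∘ₗ simplicialBoundary V R from LinearMap.congr_fun h c
    ext1 s
    ext1
    simp only [LinearMap.comp_apply, Finsupp.lsingle_apply, flagMap_succ_single]
    rw [simplicialBoundary_coneOp_eq_sub]
    simp [flagMap, simplicialBoundary_simplicialBoundary]
  | succ k ih =>
    suffices h : simplicialBoundary V R ∘ₗ flagMap R apex (k + 2) =
        flagMap R apex (k + 1) ∘ₗ simplicialBoundary V R from LinearMap.congr_fun h c
    ext1 s
    ext1
    simp only [LinearMap.comp_apply, Finsupp.lsingle_apply]
    rw [flagMap_succ_single, simplicialBoundary_coneOp_eq_sub, ih,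
      simplicialBoundary_simplicialBoundary, map_zero, map_zero, sub_zero]

theorem simplicialBoundary_flagHomotopy (k : ℕ) (c : Finset V →₀ R) :
    simplicialBoundary V R (flagHomotopy R apex (k + 1) c) =
      c - flagMap R apex (k + 1) c - flagHomotopy R apex k (simplicialBoundary V R c) := by
  induction k generalizing c with
  | zero =>
    suffices h : simplicialBoundary V R ∘ₗ flagHomotopy R apex 1 =
        LinearMap.id - flagMap R apex 1 - flagHomotopy R apex 0 ∘ₗ simplicialBoundary V R from
      LinearMap.congr_fun h c
    ext1 s
    ext1
    simp only [LinearMap.comp_apply, LinearMap.sub_apply, Finsupp.lsingle_apply, LinearMap.id_apply]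
    rw [flagHomotopy_succ_single, simplicialBoundary_coneOp_eq_sub, map_sub,
      map_sub (simplicialBoundary V R), simplicialBoundary_flagMap]
    simp [flagMap, flagHomotopy]
  | succ k ih =>
    suffices h : simplicialBoundary V R ∘ₗ flagHomotopy R apex (k + 2) =
        LinearMap.id - flagMap R apex (k + 2) -
          flagHomotopy R apex (k + 1) ∘ₗ simplicialBoundary V R from
      LinearMap.congr_fun h c
    ext1 s
    ext1
    simp only [LinearMap.comp_apply, LinearMap.sub_apply, Finsupp.lsingle_apply, LinearMap.id_apply]
    rw [flagHomotopy_succ_single, simplicialBoundary_coneOp_eq_sub, map_sub,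
      map_sub (simplicialBoundary V R), simplicialBoundary_flagMap, ih,
      simplicialBoundary_simplicialBoundary]
    simp

variable {R} {cl : Finset V → Finset V}

/-- A linear map carried by a monotone `cl` on simplices with `k` vertices is carried by `cl` on
boundaries of simplices with `k + 1` vertices. -/
theorem map_simplicialBoundary_mem_supported (hmono : Monotone cl) {k j : ℕ}
    (f : (Finset V →₀ R) →ₗ[R] (Finset V →₀ R))
    (hf : ∀ s : Finset V, s.card = k →
      f (Finsupp.single s 1) ∈ Finsupp.supported R R {t : Finset V | t ⊆ cl s ∧ t.card = j})
    {s : Finset V} (hs : s.card = k + 1) :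
    f (simplicialBoundary V R (Finsupp.single s 1)) ∈
      Finsupp.supported R R {t : Finset V | t ⊆ cl s ∧ t.card = j} := by
  rw [simplicialBoundary_single, map_sum]
  refine Submodule.sum_mem _ fun v hv => ?_
  rw [map_smul]
  refine Submodule.smul_mem _ _ (Finsupp.supported_mono ?_ (hf (s.erase v) ?_))
  · exact fun t ht => ⟨ht.1.trans (hmono (s.erase_subset v)), ht.2⟩
  · rw [Finset.card_erase_of_mem hv, hs, Nat.add_sub_cancel]

variable {apex}

theorem flagMap_mem_supported (hmono : Monotone cl)
    (hapex : ∀ s : Finset V, s.Nonempty → apex s ∈ cl s) (k : ℕ) (s : Finset V) (hs : s.card = k) :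
    flagMap R apex k (Finsupp.single s 1) ∈
      Finsupp.supported R R {t : Finset V | t ⊆ cl s ∧ t.card = k} := by
  induction k generalizing s with
  | zero =>
    rw [Finset.card_eq_zero] at hs
    subst hs
    exact Finsupp.single_mem_supported _ _ ⟨Finset.empty_subset _, rfl⟩
  | succ k ih =>
    rw [flagMap_succ_single]
    exact coneOp_mem_supported (hapex s (Finset.card_pos.1 (by omega)))
      (map_simplicialBoundary_mem_supported hmono _ ih hs)

theorem flagHomotopy_mem_supported (hmono : Monotone cl) (hsub : ∀ s, s ⊆ cl s)
    (hapex : ∀ s : Finset V, s.Nonempty → apex s ∈ cl s) (k : ℕ) (s : Finset V) (hs : s.card = k) :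
    flagHomotopy R apex k (Finsupp.single s 1) ∈
      Finsupp.supported R R {t : Finset V | t ⊆ cl s ∧ t.card = k + 1} := by
  induction k generalizing s with
  | zero => simp [flagHomotopy]
  | succ k ih =>
    rw [flagHomotopy_succ_single]
    refine coneOp_mem_supported (hapex s (Finset.card_pos.1 (by omega)))
      (Submodule.sub_mem _ (Submodule.sub_mem _ ?_ ?_) ?_)
    · exact Finsupp.single_mem_supported _ _ ⟨hsub s, hs⟩
    · exact flagMap_mem_supported hmono hapex _ s hs
    · exact map_simplicialBoundary_mem_supported hmono _ ih hs

/-- If the apex of a simplex depends only on its closure, then only those flags contribute to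
`flagMap` whose closures are strictly increasing, because `x ∧ x = 0`. -/
theorem exists_flag_of_flagMap_ne_zero {base : Finset V → V} (k : ℕ) (s : Finset V)
    (hs : s.card = k + 1)
    (h : flagMap R (fun t => base (cl t)) (k + 1) (Finsupp.single s 1) ≠ 0) :
    ∃ f : ℕ → Finset V, f k = s ∧ (∀ i ≤ k, (f i).Nonempty ∧ f i ⊆ s) ∧
      ∀ i < k, f i ⊆ f (i + 1) ∧ cl (f i) ≠ cl (f (i + 1)) := by
  induction k generalizing s with
  | zero =>
    exact ⟨fun _ => s, rfl, fun _ _ => ⟨Finset.card_pos.1 (by rw [hs]; omega), subset_rfl⟩, by simp⟩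
  | succ k ih =>
    rw [flagMap_succ_single, simplicialBoundary_single, map_sum, map_sum] at h
    obtain ⟨v, hv, hne⟩ := Finset.exists_ne_zero_of_sum_ne_zero h
    rw [map_smul, map_smul] at hne
    replace hne := right_ne_zero_of_smul hne
    have hcard : (s.erase v).card = k + 1 := by
      rw [Finset.card_erase_of_mem hv, hs, Nat.add_sub_cancel]
    obtain ⟨f, hfk, hf, hstep⟩ := ih (s.erase v) hcard (fun h0 => hne (by rw [h0, map_zero]))
    have hcl : cl (s.erase v) ≠ cl s := by
      intro hcl
      rw [flagMap_succ_single, hcl, coneOp_coneOp] at hne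
      exact hne rfl
    refine ⟨fun i => if i ≤ k then f i else s, by simp, fun i hi => ?_, fun i hi => ?_⟩
    · by_cases hik : i ≤ k
      · simpa only [if_pos hik] using
          ⟨(hf i hik).1, (hf i hik).2.trans (s.erase_subset v)⟩
      · simpa only [if_neg hik] using ⟨⟨v, hv⟩, subset_rfl⟩
    · have hik : i ≤ k := by omega
      rcases hik.lt_or_eq with hlt | rfl
      · have : i + 1 ≤ k := hlt
        simpa only [if_pos hik, if_pos this] using hstep i hlt
      · simp only [le_refl, if_true, hfk, Nat.not_succ_le_self, if_false]
        exact ⟨s.erase_subset v, hcl⟩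

theorem subsingleton_reducedHomology_iff {K : PreAbstractSimplicialComplex V} {l : ℕ} :
    Subsingleton (K.ReducedHomology R l) ↔ K.reducedCycles R l ≤ K.reducedBoundaries R l :=
  Submodule.Quotient.subsingleton_iff.trans Submodule.submoduleOf_eq_top

/-- If a closure operator preserves the faces of a complex and there are no faces
`f 0 ⊆ ⋯ ⊆ f l` with pairwise distinct closures, then the complex retracts onto the order complex
of its closed faces, whose dimension is less than `l`; hence its homology vanishes in degree `l`. -/
theorem subsingleton_reducedHomology_of_closure {K : PreAbstractSimplicialComplex V}
    (hmono : Monotone cl) (hsub : ∀ s, s ⊆ cl s) (hface : ∀ s ∈ K.faces, cl s ∈ K.faces) {l : ℕ}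
    (hchain : ¬ ∃ f : ℕ → Finset V, (∀ i ≤ l, f i ∈ K.faces) ∧
      ∀ i < l, f i ⊆ f (i + 1) ∧ cl (f i) ≠ cl (f (i + 1))) :
    Subsingleton (K.ReducedHomology R l) := by
  rw [subsingleton_reducedHomology_iff]
  rintro z ⟨hz, hz0⟩
  replace hz0 : simplicialBoundary V R z = 0 := hz0
  have hsupp : ∀ s ∈ z.support, s.card = l + 1 ∧ s ∈ K.faces := by
    intro s hs
    obtain ⟨hcard, h | h⟩ := (Finsupp.mem_supported R z).1 hz hs
    · exact ⟨hcard, h⟩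
    · simp [h] at hcard
  rcases isEmpty_or_nonempty V with hV | ⟨⟨v₀⟩⟩
  · have : z = 0 := by
      refine Finsupp.support_eq_empty.1 (Finset.eq_empty_of_forall_notMem fun s hs => ?_)
      have := (hsupp s hs).1
      rw [Finset.eq_empty_of_isEmpty s, Finset.card_empty] at this
      omega
    rw [this]
    exact Submodule.zero_mem _
  have hpick : ∀ A : Finset V, ∃ v, A.Nonempty → v ∈ A := by
    intro A
    rcases A.eq_empty_or_nonempty with rfl | ⟨v, hv⟩
    · exact ⟨v₀, fun h => absurd h Finset.not_nonempty_empty⟩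
    · exact ⟨v, fun _ => hv⟩
  choose base hbase using hpick
  have hapex : ∀ s : Finset V, s.Nonempty → base (cl s) ∈ cl s :=
    fun s hs => hbase _ (hs.mono (hsub s))
  have hsum : ∀ f : (Finset V →₀ R) →ₗ[R] (Finset V →₀ R),
      f z = ∑ s ∈ z.support, z s • f (Finsupp.single s 1) := by
    intro f
    conv_lhs => rw [← Finsupp.sum_single z, Finsupp.sum, map_sum]
    exact Finset.sum_congr rfl fun s _ => by rw [← Finsupp.smul_single_one, map_smul]
  have hflag : flagMap R (fun t => base (cl t)) (l + 1) z = 0 := by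
    rw [hsum]
    refine Finset.sum_eq_zero fun s hs => ?_
    obtain ⟨hcard, hs⟩ := hsupp s hs
    by_contra hne
    obtain ⟨f, -, hf, hstep⟩ := exists_flag_of_flagMap_ne_zero l s hcard (right_ne_zero_of_smul hne)
    exact hchain ⟨f, fun i hi => (K.isRelLowerSet_faces hs).2 (hf i hi).2 (hf i hi).1, hstep⟩
  refine ⟨flagHomotopy R (fun t => base (cl t)) (l + 1) z, ?_, ?_⟩
  · rw [hsum]
    refine Submodule.sum_mem _ fun s hs => Submodule.smul_mem _ _ ?_
    obtain ⟨hcard, hs⟩ := hsupp s hs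
    refine Finsupp.supported_mono ?_ (flagHomotopy_mem_supported hmono hsub hapex _ s hcard)
    rintro t ⟨hts, ht⟩
    exact ⟨ht, Or.inl ((K.isRelLowerSet_faces (hface s hs)).2 hts (Finset.card_pos.1 (by omega)))⟩
  · rw [simplicialBoundary_flagHomotopy, hflag, hz0, map_zero, sub_zero, sub_zero]

end Closure
end PreAbstractSimplicialComplex

/-! ### Dense subgraphs from chains of closed sets -/

namespace SimpleGraph

variable {V : Type*}

open Classical in
/-- The number of edges of `G` with both endpoints in `S`. -/
noncomputable def edgesIn (G : SimpleGraph V) (S : Finset V) : ℕ :=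
  (S.sym2.filter (· ∈ G.edgeSet)).card

theorem edgesIn_add_card_le [DecidableEq V] (G : SimpleGraph V) {u : V} {S T : Finset V}
    (hu : u ∉ S) (hTS : T ⊆ S) (hT : ∀ w ∈ T, G.Adj u w) :
    G.edgesIn S + T.card ≤ G.edgesIn (insert u S) := by
  classical
  have hinj : (T.image fun w => s(u, w)).card = T.card :=
    Finset.card_image_of_injective _ fun w w' h => Sym2.congr_right.1 h
  rw [edgesIn, edgesIn, ← hinj, ← Finset.card_union_of_disjoint]
  · refine Finset.card_le_card (Finset.union_subset ?_ ?_)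
    · exact Finset.filter_subset_filter _ (Finset.sym2_mono (Finset.subset_insert u S))
    · intro e he
      obtain ⟨w, hw, rfl⟩ := Finset.mem_image.1 he
      simp only [Finset.mem_filter, Finset.mk_mem_sym2_iff, mem_edgeSet]
      exact ⟨⟨Finset.mem_insert_self u S, Finset.mem_insert_of_mem (hTS hw)⟩, hT w hw⟩
  · rw [Finset.disjoint_left]
    intro e he he'
    obtain ⟨w, hw, rfl⟩ := Finset.mem_image.1 he'
    exact hu (Finset.mk_mem_sym2_iff.1 (Finset.mem_filter.1 he).1).1

theorem edgesIn_add_mul_card_le [DecidableEq V] (G : SimpleGraph V) {A S T : Finset V}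
    (hA : Disjoint A S) (hTS : T ⊆ S) (hT : ∀ u ∈ A, ∀ w ∈ T, G.Adj u w) :
    G.edgesIn S + A.card * T.card ≤ G.edgesIn (A ∪ S) := by
  induction A using Finset.induction_on with
  | empty => simp
  | insert u A hu ih =>
    rw [Finset.disjoint_insert_left] at hA
    have h1 := ih hA.2 fun x hx => hT x (Finset.mem_insert_of_mem hx)
    have h2 := G.edgesIn_add_card_le (u := u) (S := A ∪ S) (T := T) (by simp [hu, hA.1])
      (hTS.trans Finset.subset_union_right) (hT u (Finset.mem_insert_self u A))
    rw [Finset.insert_union, Finset.card_insert_of_notMem hu]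
    linarith

/-- A half graph with sides `a 0, …, a l` and `b 0, …, b l`, where `a i` and `b j` are adjacent for
`i ≤ j`, contains for `s + t = l + 2` a complete bipartite graph on `s + t` vertices, together with
one more vertex joined to `t - 1` of these. The two sides may share vertices; the bounds on the
numbers of vertices and edges hold in this case as well. -/
theorem exists_dense_of_halfGraph (G : SimpleGraph V) {l s t : ℕ} (hst : s + t = l + 2)
    (hs : 1 ≤ s) (ht : 2 ≤ t) (a b : ℕ → V)
    (ha : ∀ i j, i < j → j ≤ l → a i ≠ a j) (hb : ∀ i j, i < j → j ≤ l → b i ≠ b j)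
    (hab : ∀ i j, i ≤ j → j ≤ l → G.Adj (a i) (b j)) :
    ∃ S : Finset V, S.card ≤ s + t + 1 ∧ s * t + (t - 1) ≤ G.edgesIn S := by
  classical
  set A := (Finset.range s).image a with hAdef
  set B := (Finset.Icc s l).image b with hBdef
  have hA : A.card = s := by
    rw [hAdef, Finset.card_image_of_injOn, Finset.card_range]
    intro i hi j hj h
    simp only [Finset.coe_range, Set.mem_Iio] at hi hj
    rcases lt_trichotomy i j with hij | hij | hij
    · exact absurd h (ha i j hij (by omega))
    · exact hij
    · exact absurd h.symm (ha j i hij (by omega))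
  have hB : B.card = t - 1 := by
    rw [hBdef, Finset.card_image_of_injOn, Nat.card_Icc]
    · omega
    intro i hi j hj h
    simp only [Finset.coe_Icc, Set.mem_Icc] at hi hj
    rcases lt_trichotomy i j with hij | hij | hij
    · exact absurd h (hb i j hij (by omega))
    · exact hij
    · exact absurd h.symm (hb j i hij (by omega))
  have hAB : ∀ x ∈ A, ∀ y ∈ B, G.Adj x y := by
    intro x hx y hy
    obtain ⟨i, hi, rfl⟩ := Finset.mem_image.1 hx
    obtain ⟨j, hj, rfl⟩ := Finset.mem_image.1 hy
    rw [Finset.mem_range] at hi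
    rw [Finset.mem_Icc] at hj
    exact hab i j (by omega) hj.2
  have hdisj : Disjoint A B :=
    Finset.disjoint_left.2 fun x hx hx' => (hAB x hx x hx').ne rfl
  have hasB : ∀ y ∈ B, G.Adj (a s) y := by
    intro y hy
    obtain ⟨j, hj, rfl⟩ := Finset.mem_image.1 hy
    rw [Finset.mem_Icc] at hj
    exact hab s j hj.1 hj.2
  have hbA : ∀ x ∈ A, G.Adj (b (s - 1)) x := by
    intro x hx
    obtain ⟨i, hi, rfl⟩ := Finset.mem_image.1 hx
    rw [Finset.mem_range] at hi
    exact (hab i (s - 1) (by omega) (by omega)).symm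
  have has : a s ∉ A ∪ B := by
    rw [Finset.mem_union, not_or]
    refine ⟨fun h => ?_, fun h => (hasB _ h).ne rfl⟩
    obtain ⟨i, hi, h⟩ := Finset.mem_image.1 h
    exact ha i s (Finset.mem_range.1 hi) (by omega) h
  have hbs : b (s - 1) ∉ A ∪ B := by
    rw [Finset.mem_union, not_or]
    refine ⟨fun h => (hbA _ h).ne rfl, fun h => ?_⟩
    obtain ⟨j, hj, h⟩ := Finset.mem_image.1 h
    rw [Finset.mem_Icc] at hj
    exact hb (s - 1) j (by omega) hj.2 h.symm
  have hcard : (A ∪ B).card = s + (t - 1) := by rw [Finset.card_union_of_disjoint hdisj, hA, hB]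
  have h0 := G.edgesIn_add_mul_card_le hdisj subset_rfl hAB
  rw [hA, hB] at h0
  obtain ⟨t, rfl⟩ : ∃ t', t = t' + 1 := ⟨t - 1, by omega⟩
  rw [Nat.add_sub_cancel] at h0 hcard hB ⊢
  by_cases hc : b (s - 1) = a s
  · -- The coinciding vertex is joined to all of `A ∪ B`, which saves a vertex at no cost in edges.
    have h1 := G.edgesIn_add_card_le has subset_rfl (T := A ∪ B) (by
      intro w hw
      rcases Finset.mem_union.1 hw with hw | hw
      · exact hc ▸ hbA w hw
      · exact hasB w hw)
    refine ⟨insert (a s) (A ∪ B), (Finset.card_insert_le _ _).trans (by omega), ?_⟩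
    rw [hcard] at h1
    nlinarith
  · have h1 := G.edgesIn_add_card_le has Finset.subset_union_right hasB
    have h2 := G.edgesIn_add_card_le (u := b (s - 1)) (S := insert (a s) (A ∪ B)) (T := A)
      (by rw [Finset.mem_insert, not_or]; exact ⟨hc, hbs⟩)
      (Finset.subset_union_left.trans (Finset.subset_insert _ _)) hbA
    refine ⟨insert (b (s - 1)) (insert (a s) (A ∪ B)), ?_, ?_⟩
    · have h3 := Finset.card_insert_le (b (s - 1)) (insert (a s) (A ∪ B))
      have h4 := Finset.card_insert_le (a s) (A ∪ B)
      omega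
    · rw [hB] at h1
      rw [hA] at h2
      nlinarith

section CommonNeighbors

variable [Fintype V]

open Classical in
/-- The common neighbors of the vertices in `s`. -/
noncomputable def commonNbrs (G : SimpleGraph V) (s : Finset V) : Finset V :=
  Finset.univ.filter fun w => ∀ u ∈ s, G.Adj u w

theorem mem_commonNbrs {G : SimpleGraph V} {s : Finset V} {w : V} :
    w ∈ G.commonNbrs s ↔ ∀ u ∈ s, G.Adj u w := by
  simp [commonNbrs]

theorem commonNbrs_antitone (G : SimpleGraph V) : Antitone G.commonNbrs :=
  fun _ _ hst _ hw => mem_commonNbrs.2 fun u hu => mem_commonNbrs.1 hw u (hst hu)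

theorem subset_commonNbrs_commonNbrs (G : SimpleGraph V) (s : Finset V) :
    s ⊆ G.commonNbrs (G.commonNbrs s) :=
  fun _ hu => mem_commonNbrs.2 fun _ hw => (mem_commonNbrs.1 hw _ hu).symm

theorem mem_faces_multineighborComplex {m : ℕ} {G : SimpleGraph V} {s : Finset V} :
    s ∈ (multineighborComplex m G).faces ↔ s.Nonempty ∧ m ≤ (G.commonNbrs s).card := by
  have : {w : V | ∀ u ∈ s, G.Adj u w} = (G.commonNbrs s : Set V) := by
    ext w
    simp [mem_commonNbrs]
  change s.Nonempty ∧ (m : ℕ∞) ≤ {w : V | ∀ u ∈ s, G.Adj u w}.encard ↔ _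
  rw [this, Set.encard_coe_eq_coe_finsetCard, Nat.cast_le]

/-- A strictly increasing chain of `l + 1` closed sets, closed meaning equal to the common neighbors
of its common neighbors, yields a half graph: `a i` is new in the `i`-th set and `b i` is lost as a
common neighbor in the next step. -/
theorem exists_halfGraph_of_chain (G : SimpleGraph V) {l : ℕ} (f : ℕ → Finset V)
    (hne : ∀ i ≤ l, (f i).Nonempty ∧ (G.commonNbrs (f i)).Nonempty)
    (hf : ∀ i < l, f i ⊆ f (i + 1) ∧
      G.commonNbrs (G.commonNbrs (f i)) ≠ G.commonNbrs (G.commonNbrs (f (i + 1)))) :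
    ∃ a b : ℕ → V, (∀ i j, i < j → j ≤ l → a i ≠ a j) ∧ (∀ i j, i < j → j ≤ l → b i ≠ b j) ∧
      ∀ i j, i ≤ j → j ≤ l → G.Adj (a i) (b j) := by
  have hmono : ∀ i j, i ≤ j → j ≤ l → f i ⊆ f j := by
    intro i j hij
    induction j, hij using Nat.le_induction with
    | base => exact fun _ => subset_rfl
    | succ j hij ih => exact fun hj => (ih (by omega)).trans (hf j (by omega)).1
  have hcl : Monotone fun s => G.commonNbrs (G.commonNbrs s) :=
    G.commonNbrs_antitone.comp G.commonNbrs_antitone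
  have ha : ∀ i, ∃ v, i ≤ l →
      v ∈ G.commonNbrs (G.commonNbrs (f i)) ∧
        ∀ j < i, v ∉ G.commonNbrs (G.commonNbrs (f j)) := by
    intro i
    by_cases hi : i ≤ l
    · cases i with
      | zero =>
        obtain ⟨v, hv⟩ := (hne 0 hi).1
        exact ⟨v, fun _ => ⟨G.subset_commonNbrs_commonNbrs _ hv, by simp⟩⟩
      | succ i =>
        obtain ⟨hsub, hne'⟩ := hf i (by omega)
        obtain ⟨v, hv, hv'⟩ := Finset.exists_of_ssubset ((hcl hsub).lt_of_ne hne')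
        exact ⟨v, fun _ => ⟨hv, fun j hj h => hv' (hcl (hmono j i (by omega) (by omega)) h)⟩⟩
    · obtain ⟨v, _⟩ := (hne 0 (Nat.zero_le l)).1
      exact ⟨v, fun h => absurd h hi⟩
  have hb : ∀ i, ∃ w, i ≤ l → w ∈ G.commonNbrs (f i) ∧
        ∀ j, i < j → j ≤ l → w ∉ G.commonNbrs (f j) := by
    intro i
    rcases lt_or_ge i l with hi | hi
    · obtain ⟨hsub, hne'⟩ := hf i hi
      obtain ⟨w, hw, hw'⟩ := Finset.exists_of_ssubset
        ((G.commonNbrs_antitone hsub).lt_of_ne fun h => hne' (by rw [h]))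
      exact ⟨w, fun _ => ⟨hw, fun j hij hj h =>
        hw' (G.commonNbrs_antitone (hmono (i + 1) j hij hj) h)⟩⟩
    · obtain ⟨w, hw⟩ := (hne l le_rfl).2
      refine ⟨w, fun h => ?_⟩
      obtain rfl : i = l := by omega
      exact ⟨hw, fun j _ _ => by omega⟩
  choose a ha using ha
  choose b hb using hb
  refine ⟨a, b, fun i j hij hj h => ?_, fun i j hij hj h => ?_, fun i j hij hj => ?_⟩
  · exact (ha j hj).2 i hij (h ▸ (ha i (by omega)).1)
  · exact (hb i (by omega)).2 j hij hj (h ▸ (hb j hj).1)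
  · exact (mem_commonNbrs.1 (hcl (hmono i j hij hj) (ha i (by omega)).1) _ (hb j hj).1).symm

end CommonNeighbors

/-- If every set of at most seven vertices spans at most as many edges as it has vertices, then a
all `4`-cycles through a vertex `v` pass through the same two neighbors of `v`. The case `w = w'`
says that there is no complete bipartite graph on `2 + 3` vertices. -/
theorem pair_eq_of_sparse [DecidableEq V] {G : SimpleGraph V}
    (hG : ∀ S : Finset V, S.card ≤ 7 → G.edgesIn S ≤ S.card) {v w w' x y x' y' : V}
    (hw : v ≠ w) (hw' : v ≠ w') (hxy : x ≠ y) (hxy' : x' ≠ y')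
    (hvx : G.Adj v x) (hvy : G.Adj v y) (hwx : G.Adj w x) (hwy : G.Adj w y)
    (hvx' : G.Adj v x') (hvy' : G.Adj v y') (hwx' : G.Adj w' x') (hwy' : G.Adj w' y') :
    ({x, y} : Finset V) = {x', y'} := by
  suffices key : ∀ x' y' : V, x' ≠ y' → G.Adj v x' → G.Adj v y' → G.Adj w' x' → G.Adj w' y' →
      x' = x ∨ x' = y by
    have h1 := key x' y' hxy' hvx' hvy' hwx' hwy'
    have h2 := key y' x' hxy'.symm hvy' hvx' hwy' hwx'
    grind
  clear hxy' hvx' hvy' hwx' hwy' x' y'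
  intro x' y' hxy' hvx' hvy' hwx' hwy'
  by_contra! hcon
  have h2 := G.edgesIn_add_card_le (u := v) (S := {x, y}) (T := {x, y})
    (by simp [hvx.ne, hvy.ne]) subset_rfl (by simp [hvx, hvy])
  have c2 : ({x, y} : Finset V).card = 2 := Finset.card_pair hxy
  have c3 : ({v, x, y} : Finset V).card = 3 := by
    rw [Finset.card_insert_of_notMem (by simp [hvx.ne, hvy.ne]), c2]
  have hwS : w ∉ ({v, x, y} : Finset V) := by simp [hw.symm, hwx.ne, hwy.ne]
  have c4 : ({w, v, x, y} : Finset V).card = 4 := by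
    rw [Finset.card_insert_of_notMem hwS, c3]
  by_cases hx'w : x' = w
  · subst hx'w
    have h3 := G.edgesIn_add_card_le hwS (T := {v, x, y}) subset_rfl (by simp [hwx, hwy, hvx'.symm])
    have := hG _ (c4.trans_le (by norm_num))
    omega
  have h3 := G.edgesIn_add_card_le hwS (T := {x, y}) (by simp) (by simp [hwx, hwy])
  have hx'S : x' ∉ ({w, v, x, y} : Finset V) := by simp [hx'w, hvx'.ne', hcon.1, hcon.2]
  have c5 : ({x', w, v, x, y} : Finset V).card = 5 := by
    rw [Finset.card_insert_of_notMem hx'S, c4]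
  by_cases hw'S : w' ∈ ({w, v, x, y} : Finset V)
  · have h4 := G.edgesIn_add_card_le hx'S (T := {v, w'})
      (by intro q; simp only [Finset.mem_insert, Finset.mem_singleton] at hw'S ⊢; grind)
      (by simp [hvx'.symm, hwx'.symm])
    rw [Finset.card_pair hw'] at h4
    have := hG _ (c5.trans_le (by norm_num))
    omega
  have h4 := G.edgesIn_add_card_le hx'S (T := {v}) (by simp) (by simp [hvx'.symm])
  rw [Finset.card_singleton] at h4
  have hw'S' : w' ∉ ({x', w, v, x, y} : Finset V) := by
    rw [Finset.mem_insert, not_or]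
    exact ⟨hwx'.ne, hw'S⟩
  by_cases hy'S : y' ∈ ({x', w, v, x, y} : Finset V)
  · have h5 := G.edgesIn_add_card_le hw'S' (T := {x', y'})
      (by intro q; simp only [Finset.mem_insert, Finset.mem_singleton] at hy'S ⊢; grind)
      (by simp [hwx', hwy'])
    rw [Finset.card_pair hxy'] at h5
    have c6 := Finset.card_insert_of_notMem hw'S'
    have := hG _ (c6.trans_le (by omega))
    omega
  · have h5 := G.edgesIn_add_card_le hy'S (T := {v}) (by simp) (by simp [hvy'.symm])
    rw [Finset.card_singleton] at h5
    have c6 := Finset.card_insert_of_notMem hy'S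
    have hw'S'' : w' ∉ ({y', x', w, v, x, y} : Finset V) := by
      rw [Finset.mem_insert, not_or]
      exact ⟨hwy'.ne, hw'S'⟩
    have h6 := G.edgesIn_add_card_le hw'S'' (T := {x', y'})
      (by intro q; simp only [Finset.mem_insert, Finset.mem_singleton]; grind)
      (by simp [hwx', hwy'])
    rw [Finset.card_pair hxy'] at h6
    have c7 := Finset.card_insert_of_notMem hw'S''
    have := hG _ (c7.trans_le (by omega))
    omega

end SimpleGraph

/-! ### Vanishing of the homology of the multineighbor complex -/

namespace PreAbstractSimplicialComplex

variable {V : Type*} [LinearOrder V] {R : Type*} [CommRing R]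

theorem simplicialBoundary_mem_supported {A : Finset V} {k : ℕ} {c : Finset V →₀ R}
    (hc : c ∈ Finsupp.supported R R {t : Finset V | t ⊆ A ∧ t.card = k + 1}) :
    simplicialBoundary V R c ∈ Finsupp.supported R R {t : Finset V | t ⊆ A ∧ t.card = k} := by
  rw [simplicialBoundary, Finsupp.linearCombination_apply]
  refine Submodule.sum_mem _ fun s hs => Submodule.smul_mem _ _ (Submodule.sum_mem _ fun v hv =>
    Submodule.smul_mem _ _ (Finsupp.single_mem_supported _ _ ?_))
  obtain ⟨hsA, hsk⟩ := (Finsupp.mem_supported R c).1 hc hs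
  exact ⟨(s.erase_subset v).trans hsA, by rw [Finset.card_erase_of_mem hv, hsk, Nat.add_sub_cancel]⟩

/-- A nonzero multiple of a single nonempty simplex is not a cycle. -/
theorem eq_zero_of_support_subset_singleton {c : Finset V →₀ R} {e : Finset V} (he : e.Nonempty)
    (hc : c.support ⊆ {e}) (hc0 : simplicialBoundary V R c = 0) : c = 0 := by
  obtain ⟨x, hx⟩ := he
  have h := simplicialBoundary_coneOp x c
  obtain ⟨r, rfl⟩ := Finsupp.support_subset_singleton'.1 hc
  rw [hc0, map_zero, add_zero, ← Finsupp.smul_single_one, map_smul, coneOp_single, if_pos hx,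
    smul_zero, map_zero] at h
  rw [← Finsupp.smul_single_one, ← h]

open SimpleGraph

/-- A half graph in `G` with `l + 1` vertices on each side is necessary for nonvanishing homology in
degree `l`. -/
theorem subsingleton_reducedHomology_of_no_halfGraph [Fintype V] {G : SimpleGraph V} {l m : ℕ}
    (hm : 0 < m)
    (hG : ¬ ∃ a b : ℕ → V, (∀ i j, i < j → j ≤ l → a i ≠ a j) ∧
      (∀ i j, i < j → j ≤ l → b i ≠ b j) ∧ ∀ i j, i ≤ j → j ≤ l → G.Adj (a i) (b j)) :
    Subsingleton ((multineighborComplex m G).ReducedHomology R l) := by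
  refine subsingleton_reducedHomology_of_closure
    (cl := fun s => G.commonNbrs (G.commonNbrs s))
    (G.commonNbrs_antitone.comp G.commonNbrs_antitone) G.subset_commonNbrs_commonNbrs ?_ ?_
  · intro s hs
    rw [mem_faces_multineighborComplex] at hs ⊢
    exact ⟨hs.1.mono (G.subset_commonNbrs_commonNbrs s),
      hs.2.trans (Finset.card_le_card (G.subset_commonNbrs_commonNbrs _))⟩
  · rintro ⟨f, hf, hstep⟩
    refine hG (G.exists_halfGraph_of_chain f (fun i hi => ?_) hstep)
    have := mem_faces_multineighborComplex.1 (hf i hi)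
    exact ⟨this.1, Finset.card_pos.1 (hm.trans_le this.2)⟩

/-- When `4`-cycles are isolated in the sense of `SimpleGraph.pair_eq_of_sparse`, the part of a
`2`-cycle inside one neighborhood has its boundary on a single edge, so this part is a cycle
itself, and bounds in the simplex spanned by the neighborhood. -/
theorem subsingleton_reducedHomology_two_of_sparse [Fintype V] {G : SimpleGraph V} {m : ℕ}
    (hm : 0 < m) (hG : ∀ S : Finset V, S.card ≤ 7 → G.edgesIn S ≤ S.card) :
    Subsingleton ((multineighborComplex m G).ReducedHomology R 2) := by
  rw [subsingleton_reducedHomology_iff]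
  rintro z ⟨hz, hz0⟩
  replace hz0 : simplicialBoundary V R z = 0 := hz0
  have hsupp : ∀ s ∈ z.support, s.card = 3 ∧ m ≤ (G.commonNbrs s).card := by
    intro s hs
    obtain ⟨hcard, h | h⟩ := (Finsupp.mem_supported R z).1 hz hs
    · exact ⟨hcard, (mem_faces_multineighborComplex.1 h).2⟩
    · simp [h] at hcard
  rcases Nat.lt_or_ge 1 m with hm1 | hm1
  · -- Two common neighbors of a triangle give a complete bipartite graph on `2 + 3` vertices.
    have : z = 0 := by
      refine Finsupp.support_eq_empty.1 (Finset.eq_empty_of_forall_notMem fun s hs => ?_)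
      obtain ⟨hcard, hle⟩ := hsupp s hs
      obtain ⟨v, hv, w, hw, hvw⟩ := Finset.one_lt_card.1 (hm1.trans_le hle)
      rw [mem_commonNbrs] at hv hw
      obtain ⟨x, y, t, hxy, hxt, hyt, rfl⟩ := Finset.card_eq_three.1 hcard
      simp only [Finset.mem_insert, Finset.mem_singleton, forall_eq_or_imp, forall_eq] at hv hw
      have := pair_eq_of_sparse hG hvw hvw hxy hxt hv.1.symm hv.2.1.symm hw.1.symm hw.2.1.symm
        hv.1.symm hv.2.2.symm hw.1.symm hw.2.2.symm
      have hy : y ∈ ({x, t} : Finset V) := this ▸ by simp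
      simp [hxy.symm, hyt] at hy
    rw [this]
    exact Submodule.zero_mem _
  obtain rfl : m = 1 := by omega
  -- Each triangle is assigned to one vertex whose neighborhood contains it.
  have hpick : ∀ s : Finset V, ∃ v : Option V, s ∈ z.support →
      ∃ u, v = some u ∧ s ⊆ G.commonNbrs {u} := by
    intro s
    by_cases hs : s ∈ z.support
    · obtain ⟨u, hu⟩ := Finset.card_pos.1 (hsupp s hs).2
      refine ⟨some u, fun _ => ⟨u, rfl, fun x hx => ?_⟩⟩
      rw [mem_commonNbrs] at hu ⊢
      simpa using (hu x hx).symm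
    · exact ⟨none, fun h => absurd h hs⟩
  choose g hg using hpick
  set part : V → (Finset V →₀ R) := fun v => z.filter fun s => g s = some v with hpart
  have hsum : z = ∑ v, part v := by
    ext s
    rw [Finsupp.finsetSum_apply]
    simp only [hpart, Finsupp.filter_apply]
    by_cases hs : s ∈ z.support
    · obtain ⟨u, hu, -⟩ := hg s hs
      simp [hu]
    · simp [Finsupp.notMem_support_iff.1 hs]
  have hmem : ∀ v, part v ∈
      Finsupp.supported R R {t : Finset V | t ⊆ G.commonNbrs {v} ∧ t.card = 2 + 1} := by
    intro v
    rw [Finsupp.mem_supported]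
    intro s hs
    rw [Finset.mem_coe, hpart, Finsupp.support_filter, Finset.mem_filter] at hs
    obtain ⟨u, hu, hsu⟩ := hg s hs.1
    obtain rfl : u = v := Option.some_injective _ (hu.symm.trans hs.2)
    exact ⟨hsu, (hsupp s hs.1).1⟩
  have hbd := fun v => simplicialBoundary_mem_supported (hmem v)
  -- An edge in the boundary of one part must cancel against another part.
  have hother : ∀ v, ∀ e ∈ (simplicialBoundary V R (part v)).support,
      e.card = 2 ∧ ∃ w, v ≠ w ∧ e ⊆ G.commonNbrs {v} ∧ e ⊆ G.commonNbrs {w} := by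
    intro v e he
    obtain ⟨hev, hcard⟩ := (Finsupp.mem_supported R _).1 (hbd v) he
    refine ⟨hcard, ?_⟩
    by_contra! hcon
    rw [hsum, map_sum] at hz0
    have h := DFunLike.congr_fun hz0 e
    rw [Finsupp.finsetSum_apply, Finset.sum_eq_single v] at h
    · exact Finsupp.mem_support_iff.1 he h
    · intro w _ hwv
      by_contra hne
      exact hcon w hwv.symm hev
        ((Finsupp.mem_supported R _).1 (hbd w) (Finsupp.mem_support_iff.2 hne)).1
    · simp
  -- So it spans a `4`-cycle through `v`, and all of these determine the same edge.
  have hcycle : ∀ v, simplicialBoundary V R (part v) = 0 := by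
    intro v
    by_contra hne
    obtain ⟨e, he⟩ := Finsupp.support_nonempty_iff.2 hne
    refine hne (eq_zero_of_support_subset_singleton (e := e) ?_ ?_
      (simplicialBoundary_simplicialBoundary _))
    · exact Finset.card_pos.1 (by rw [(hother v e he).1]; norm_num)
    intro e' he'
    rw [Finset.mem_singleton]
    obtain ⟨hcard, w, hvw, hev, hew⟩ := hother v e he
    obtain ⟨hcard', w', hvw', hev', hew'⟩ := hother v e' he'
    obtain ⟨x, y, hxy, rfl⟩ := Finset.card_eq_two.1 hcard
    obtain ⟨x', y', hxy', rfl⟩ := Finset.card_eq_two.1 hcard'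
    simp only [Finset.insert_subset_iff, Finset.singleton_subset_iff, mem_commonNbrs,
      Finset.mem_singleton, forall_eq] at hev hew hev' hew'
    exact (pair_eq_of_sparse hG hvw hvw' hxy hxy' hev.1 hev.2 hew.1 hew.2 hev'.1 hev'.2
      hew'.1 hew'.2).symm
  rw [hsum]
  refine Submodule.sum_mem _ fun v _ => ?_
  rcases (G.commonNbrs {v}).eq_empty_or_nonempty with h | ⟨x, hx⟩
  · have h0 : part v = 0 := by
      refine Finsupp.support_eq_empty.1 (Finset.eq_empty_of_forall_notMem fun s hs => ?_)
      obtain ⟨hs, hcard⟩ := (Finsupp.mem_supported R _).1 (hmem v) hs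
      rw [h, Finset.subset_empty] at hs
      simp [hs] at hcard
    rw [h0]
    exact Submodule.zero_mem _
  · refine ⟨coneOp R x (part v), ?_, ?_⟩
    · refine Finsupp.supported_mono ?_ (coneOp_mem_supported hx (hmem v))
      rintro t ⟨htv, ht⟩
      refine ⟨ht, Or.inl (mem_faces_multineighborComplex.2 ⟨?_, ?_⟩)⟩
      · exact Finset.card_pos.1 (by omega)
      · refine Finset.card_pos.2 ⟨v, mem_commonNbrs.2 fun u hu => ?_⟩
        exact (mem_commonNbrs.1 (htv hu) v (Finset.mem_singleton_self v)).symm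
    · rw [simplicialBoundary_coneOp_eq_sub, hcycle, map_zero, sub_zero]

end PreAbstractSimplicialComplex

/-! ### Dense subgraphs of random graphs -/

namespace SimpleGraph

open MeasureTheory ProbabilityTheory unitInterval
open scoped ENNReal

theorem binomialRandom_setOf_subset_edgeSet_le {V : Type*} [Finite V] (p : I)
    (T : Finset (Sym2 V)) :
    binomialRandom V p {G | ∀ e ∈ T, e ∈ G.edgeSet} ≤ (toNNReal p : ℝ≥0∞) ^ T.card := by
  classical
  rw [binomialRandom_apply', setBernoulli_apply']
  refine (measure_mono (t := Set.pi (T : Set (Sym2 V)) fun _ => {True}) ?_).trans ?_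
  · rintro q ⟨G, hG, hGq⟩ e he
    have h := hG e he
    rw [hGq] at h
    simpa using h
  · rw [Measure.infinitePi_pi _ (fun _ _ => MeasurableSet.of_discrete), ← Finset.prod_const]
    refine Finset.prod_le_prod' fun e _ => ?_
    have h : (Measure.dirac False) {True} = 0 := by simp
    rw [Measure.add_apply, Measure.smul_apply, Measure.smul_apply, h, smul_zero, add_zero,
      ENNReal.smul_def, smul_eq_mul]
    exact mul_le_of_le_one_right zero_le prob_le_one

/-- First moment bound: there are at most `(v + 1) n ^ v` sets of at most `v` vertices, each with a
bounded number of sets of `e` pairs. -/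
theorem binomialRandom_exists_dense_le {n : ℕ} (hn : 1 ≤ n) (p : I) (v e : ℕ) :
    binomialRandom (Fin n) p {G | ∃ S : Finset (Fin n), S.card ≤ v ∧ e ≤ G.edgesIn S} ≤
      ((v + 1) * n ^ v * 2 ^ ((v + 1).choose 2) : ℕ) * (toNNReal p : ℝ≥0∞) ^ e := by
  classical
  set I₁ : Finset (Finset (Fin n)) :=
    (Finset.range (v + 1)).biUnion fun k => Finset.univ.powersetCard k with hI₁
  set I₂ : Finset (Σ _ : Finset (Fin n), Finset (Sym2 (Fin n))) :=
    I₁.sigma fun S => S.sym2.powersetCard e with hI₂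
  have hcard : I₂.card ≤ (v + 1) * n ^ v * 2 ^ ((v + 1).choose 2) := by
    rw [hI₂, Finset.card_sigma]
    refine (Finset.sum_le_card_nsmul _ _ (2 ^ ((v + 1).choose 2)) fun S hS => ?_).trans ?_
    · have hSv : S.card ≤ v := by
        simp only [hI₁, Finset.mem_biUnion, Finset.mem_range, Finset.mem_powersetCard] at hS
        omega
      rw [Finset.card_powersetCard, Finset.card_sym2]
      exact (Nat.choose_le_two_pow _ _).trans
        (Nat.pow_le_pow_right (by norm_num) (Nat.choose_le_choose 2 (by omega)))
    · rw [smul_eq_mul]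
      refine Nat.mul_le_mul_right _ (Finset.card_biUnion_le.trans ?_)
      refine (Finset.sum_le_card_nsmul _ _ (n ^ v) fun k hk => ?_).trans (by simp)
      rw [Finset.card_powersetCard, Finset.card_univ, Fintype.card_fin]
      rw [Finset.mem_range] at hk
      exact (Nat.choose_le_pow n k).trans (Nat.pow_le_pow_right hn (by omega))
  have hsub : {G : SimpleGraph (Fin n) | ∃ S : Finset (Fin n), S.card ≤ v ∧ e ≤ G.edgesIn S} ⊆
      ⋃ x ∈ I₂, {G | ∀ a ∈ x.2, a ∈ G.edgeSet} := by
    rintro G ⟨S, hS, he⟩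
    obtain ⟨T, hTS, hT⟩ := Finset.exists_subset_card_eq he
    refine Set.mem_biUnion (x := (⟨S, T⟩ : Σ _ : Finset (Fin n), Finset (Sym2 (Fin n)))) ?_ ?_
    · simp only [hI₂, hI₁, Finset.mem_coe, Finset.mem_sigma, Finset.mem_biUnion, Finset.mem_range,
        Finset.mem_powersetCard]
      exact ⟨⟨S.card, by omega, Finset.subset_univ S, rfl⟩, hTS.trans (Finset.filter_subset _ _), hT⟩
    · exact fun a ha => (Finset.mem_filter.1 (hTS ha)).2
  calc _ ≤ _ := measure_mono hsub
    _ ≤ ∑ x ∈ I₂, binomialRandom (Fin n) p {G | ∀ a ∈ x.2, a ∈ G.edgeSet} :=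
      measure_biUnion_finset_le _ _
    _ ≤ ∑ _x ∈ I₂, (toNNReal p : ℝ≥0∞) ^ e := by
      refine Finset.sum_le_sum fun x hx => ?_
      have := (Finset.mem_powersetCard.1 (Finset.mem_sigma.1 hx).2).2
      exact this ▸ binomialRandom_setOf_subset_edgeSet_le p x.2
    _ ≤ _ := by
      rw [Finset.sum_const, nsmul_eq_mul]
      gcongr

theorem tendsto_binomialRandom_exists_dense {α : ℝ} {p : ℕ → I}
    (hp : ∀ n : ℕ, 0 < n → (p n : ℝ) = (n : ℝ) ^ α) {v e : ℕ} (hve : v + α * e < 0) :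
    Tendsto (fun n => binomialRandom (Fin n) (p n)
      {G | ∃ S : Finset (Fin n), S.card ≤ v ∧ e ≤ G.edgesIn S}) atTop (𝓝 0) := by
  have hlim : Tendsto (fun n : ℕ => ENNReal.ofReal
      ((v + 1) * 2 ^ ((v + 1).choose 2) * (n : ℝ) ^ (v + α * e))) atTop (𝓝 0) := by
    rw [← ENNReal.ofReal_zero]
    refine ENNReal.tendsto_ofReal ?_
    have h := (tendsto_rpow_neg_atTop (neg_pos.2 hve)).comp (tendsto_natCast_atTop_atTop (R := ℝ))
    simpa using h.const_mul (((v : ℝ) + 1) * 2 ^ ((v + 1).choose 2))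
  refine tendsto_of_tendsto_of_tendsto_of_le_of_le' tendsto_const_nhds hlim
    (Eventually.of_forall fun _ => zero_le) ?_
  filter_upwards [eventually_ge_atTop 1] with n hn
  refine (binomialRandom_exists_dense_le hn (p n) v e).trans_eq ?_
  have hn0 : (0 : ℝ) < n := by exact_mod_cast hn
  have hpn : (toNNReal (p n) : ℝ≥0∞) = ENNReal.ofReal ((n : ℝ) ^ α) := by
    rw [← hp n hn, ENNReal.ofReal]
    congr 1
    ext
    simp [(p n).2.1]
  rw [hpn, ← ENNReal.ofReal_natCast, ← ENNReal.ofReal_pow (by positivity),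
    ← ENNReal.ofReal_mul (by positivity), Real.rpow_add hn0, Real.rpow_natCast, Real.rpow_mul hn0.le,
    Real.rpow_natCast]
  push_cast
  ring_nf

theorem tendsto_binomialRandom_one {p : ℕ → I} {Q B : ∀ n : ℕ, Set (SimpleGraph (Fin n))}
    (hB : Tendsto (fun n => binomialRandom (Fin n) (p n) (B n)) atTop (𝓝 0))
    (hQ : ∀ n, (B n)ᶜ ⊆ Q n) :
    Tendsto (fun n => binomialRandom (Fin n) (p n) (Q n)) atTop (𝓝 1) := by
  have h1 : Tendsto (fun n => 1 - binomialRandom (Fin n) (p n) (B n)) atTop (𝓝 1) := by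
    simpa using ENNReal.Tendsto.sub tendsto_const_nhds hB (Or.inl ENNReal.one_ne_top)
  refine tendsto_of_tendsto_of_tendsto_of_le_of_le h1 tendsto_const_nhds (fun n => ?_)
    fun n => prob_le_one
  refine le_trans ?_ (measure_mono (hQ n))
  rw [tsub_le_iff_left, ← measure_univ (μ := binomialRandom (Fin n) (p n)),
    ← Set.union_compl_self (B n)]
  exact measure_union_le _ _

end SimpleGraph

/-! ### The multineighbor complex of a random graph -/

open SimpleGraph PreAbstractSimplicialComplex in
theorem proposition4 (R : Type*) [CommRing R] (l m : ℕ) (hl : 0 < l) (hm : 0 < m) (α : ℝ)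
    (hα : (Even l ∧ α ∈ Set.Icc (-2 : ℝ) (-4 / ((l : ℝ) + 2))) ∨
      (Odd l ∧ α ∈ Set.Icc (-2 : ℝ) (-4 * ((l : ℝ) + 2) / (((l : ℝ) + 1) * ((l : ℝ) + 3)))))
    (p : ℕ → unitInterval) (hp : ∀ n : ℕ, 0 < n → (p n : ℝ) = (n : ℝ) ^ α) :
    Tendsto
      (fun n : ℕ => SimpleGraph.binomialRandom (Fin n) (p n)
        {G : SimpleGraph (Fin n) |
          Subsingleton ((multineighborComplex m G).ReducedHomology R l)})
      atTop (𝓝 1) := by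
  have main : ∀ s t : ℕ, s + t = l + 2 → 1 ≤ s → 2 ≤ t →
      ((s + t + 1 : ℕ) : ℝ) + α * (s * t + (t - 1) : ℕ) < 0 →
      Tendsto (fun n : ℕ => SimpleGraph.binomialRandom (Fin n) (p n)
        {G : SimpleGraph (Fin n) |
          Subsingleton ((multineighborComplex m G).ReducedHomology R l)}) atTop (𝓝 1) := by
    intro s t hst hs ht hlt
    refine tendsto_binomialRandom_one (tendsto_binomialRandom_exists_dense hp hlt) fun n G hG => ?_
    refine subsingleton_reducedHomology_of_no_halfGraph hm ?_
    rintro ⟨a, b, ha, hb, hab⟩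
    exact hG (G.exists_dense_of_halfGraph hst hs ht a b ha hb hab)
  rcases hα with ⟨⟨k, rfl⟩, -, hα⟩ | ⟨⟨k, rfl⟩, -, hα⟩
  · rcases Nat.lt_or_ge k 2 with hk | hk
    · obtain rfl : k = 1 := by omega
      -- At `α = -1` a `4`-cycle with pendant edges has positive probability, so sparsity is used.
      have hα1 : α ≤ -1 := hα.trans_eq (by norm_num)
      have hsum : Tendsto (fun n : ℕ => ∑ v ∈ Finset.range 8,
          SimpleGraph.binomialRandom (Fin n) (p n)
            {G | ∃ S : Finset (Fin n), S.card ≤ v ∧ v + 1 ≤ G.edgesIn S}) atTop (𝓝 0) := by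
        rw [← Finset.sum_const_zero (s := Finset.range 8)]
        refine tendsto_finsetSum _ fun v _ => tendsto_binomialRandom_exists_dense hp ?_
        push_cast
        nlinarith [v.cast_nonneg (α := ℝ)]
      refine tendsto_binomialRandom_one (tendsto_of_tendsto_of_tendsto_of_le_of_le
        tendsto_const_nhds hsum (fun _ => zero_le)
        fun n => MeasureTheory.measure_biUnion_finset_le _ _) fun n G hG => ?_
      refine subsingleton_reducedHomology_two_of_sparse hm fun S hS => ?_
      by_contra! hlt
      exact hG (Set.mem_biUnion (x := S.card) (by simp; omega) ⟨S, le_rfl, hlt⟩)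
    · refine main (k + 1) (k + 1) (by omega) (by omega) (by omega) ?_
      have hk2 : (2 : ℝ) ≤ k := by exact_mod_cast hk
      rw [le_div_iff₀ (by positivity)] at hα
      rw [Nat.add_sub_cancel]
      push_cast at hα ⊢
      nlinarith
  · refine main (k + 1) (k + 2) (by omega) (by omega) (by omega) ?_
    have hk0 : (0 : ℝ) ≤ k := k.cast_nonneg
    rw [le_div_iff₀ (by positivity)] at hα
    rw [show k + 2 - 1 = k + 1 by omega]
    push_cast at hα ⊢
    nlinarith
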